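/- A staircase tableau of size $n\ge 1$ is a filling of the boxes of the Young diagram of shape $(n,n-1,\dots,2,1)$ (English convention) such that each box is empty or contains one of the letters $\alpha,\beta,\gamma,\delta$; no box on the diagonal (the last box of each row) is empty; all boxes in the same row and to the left of a $\beta$ or a $\delta$ are empty; and all boxes in the same column and above an $\alpha$ or a $\gamma$ are empty. Let $\mathcal S_n$ be the finite set of all staircase tableaux of size $n$, equipped with the uniform probability measure $\mathsf P_n$, and for $S\in\mathcal S_n$ let $r_n(S)$ be the number of rows of $S$ whose leftmost (nonempty) entry is $\alpha$ or $\gamma$. Then for every $n\ge1$ $$r_n\stackrel{d}{=}\sum_{k=1}^n J_k,$$ where $J_1,\dots,J_n$ are independent random variables, $J_k$ being $1$ with probability $1/(2k)$ and $0$ with probability $1-1/(2k)$. In particular, with $H_n=\sum_{k=1}^n \frac1k$ and $H_n^{(2)}=\sum_{k=1}^n\frac1{k^2}$, $$\mathsf E_n r_n=\sum_{k=1}^n\frac1{2k}=\frac{H_n}{2},\qquad \operatorname{var}(r_n)=\sum_{k=1}^n\frac1{2k}\left(1-\frac1{2k}\right)=\frac{H_n}{2}-\frac{H_n^{(2)}}{4}.$$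 Furthermore, as $n\to\infty$, $$\frac{r_n-\frac12\ln n}{\sqrt{\frac12\ln n}}\ \stackrel{d}{\longrightarrow}\ N(0,1).$$ -/

import Mathlib

open MeasureTheory ProbabilityTheory Filter

/-- The four letters that may fill a box of a staircase tableau. -/
inductive Greek where
  | α
  | β
  | γ
  | δ
  deriving DecidableEq

instance : Fintype Greek where
  elems := {Greek.α, Greek.β, Greek.γ, Greek.δ}
  complete := by
    intro x
    cases x <;> decide

/-- A staircase tableau of size `n`: a filling of the Young diagram (in English convention) of
shape `(n, n-1, …, 1)`. Rows are numbered `0, …, n-1` from top to bottom and columns `0, …, n-1`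
from left to right, so the boxes are the `(i, j)` with `i + j < n` and the diagonal boxes are those
with `i + j + 1 = n`. The value `none` stands for an empty box; positions outside the diagram carry
the value `none` by convention. -/
@[ext]
structure StaircaseTableau (n : ℕ) where
  /-- the content of the box in row `i` and column `j` -/
  entry : Fin n → Fin n → Option Greek
  /-- nothing is written outside the diagram -/
  outside : ∀ i j : Fin n, n ≤ (i : ℕ) + (j : ℕ) → entry i j = none
  /-- no box on the diagonal is empty -/
  diagonal : ∀ i j : Fin n, (i : ℕ) + (j : ℕ) + 1 = n → entry i j ≠ none
  /-- all boxes in the same row and to the left of a `β` or a `δ` are empty -/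
  left_empty : ∀ i j j' : Fin n, (entry i j = some Greek.β ∨ entry i j = some Greek.δ) →
    j' < j → entry i j' = none
  /-- all boxes in the same column and above an `α` or a `γ` are empty -/
  above_empty : ∀ i i' j : Fin n, (entry i j = some Greek.α ∨ entry i j = some Greek.γ) →
    i' < i → entry i' j = none

namespace StaircaseTableau

/-- Row `i` of `S` is indexed by the set `s` of letters: its leftmost (nonempty) entry is a member
of `s`. -/
def IndexedBy {n : ℕ} (S : StaircaseTableau n) (i : Fin n) (s : Set Greek) : Prop :=
  ∃ (j : Fin n) (x : Greek), S.entry i j = some x ∧ (∀ j' : Fin n, j' < j → S.entry i j' = none) ∧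
    x ∈ s

/-- The number `r_n(S)` of rows of `S` indexed by `α` or `γ`. -/
noncomputable def r {n : ℕ} (S : StaircaseTableau n) : ℕ :=
  {i : Fin n | S.IndexedBy i {Greek.α, Greek.γ}}.ncard

instance instFinite (n : ℕ) : Finite (StaircaseTableau n) :=
  Finite.of_injective (fun S : StaircaseTableau n => S.entry) fun _ _ h => StaircaseTableau.ext h

/-- There is a tableau of every size, for example the one with `α` in all diagonal boxes and all
other boxes empty. -/
instance instNonempty (n : ℕ) : Nonempty (StaircaseTableau n) := by
  refine ⟨⟨fun i j => if (i : ℕ) + (j : ℕ) + 1 = n then some Greek.α else none, ?_, ?_, ?_, ?_⟩⟩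
  · intro i j h
    exact if_neg (by omega)
  · intro i j h
    simp [h]
  · intro i j j' h
    split_ifs at h <;> simp at h
  · intro i i' j h hlt
    have hlt' : (i' : ℕ) < i := hlt
    split_ifs at h with h1
    · exact if_neg (by omega)
    · simp at h

/-- Every subset of the finite set of tableaux of size `n` is an event. -/
instance instMeasurableSpace (n : ℕ) : MeasurableSpace (StaircaseTableau n) := ⊤

instance instDiscreteMeasurableSpace (n : ℕ) : DiscreteMeasurableSpace (StaircaseTableau n) :=
  ⟨fun _ => trivial⟩

end StaircaseTableau

/-- The uniform probability measure on the set of staircase tableaux of size `n`. -/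
noncomputable def tableauMeasure (n : ℕ) : Measure (StaircaseTableau n) :=
  uniformOn Set.univ

instance instIsProbabilityMeasureTableauMeasure (n : ℕ) :
    IsProbabilityMeasure (tableauMeasure n) := by
  unfold tableauMeasure
  infer_instance

/-- `J 0, …, J (n-1)` are independent random variables under `P`, and, with `k = i + 1`, the
variable `J i` is `1` with probability `1/(2k)` and `0` with the remaining probability. -/
structure IsIndepBernoulliFamily (n : ℕ) {Ω : Type*} [MeasurableSpace Ω] (P : Measure Ω)
    (J : Fin n → Ω → ℕ) : Prop where
  measurable : ∀ i, Measurable (J i)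
  indep : iIndepFun J P
  prob_one : ∀ i, P {ω | J i ω = 1} = ENNReal.ofReal (1 / (2 * ((i : ℝ) + 1)))
  prob_zero : ∀ i, P {ω | J i ω = 0} = ENNReal.ofReal (1 - 1 / (2 * ((i : ℝ) + 1)))

/-!
Every letter to the left of a `β` or `δ` being forbidden, a row is indexed by `α` or `γ` exactly if
it contains neither `β` nor `δ`; call such a row free, so that `r` counts the free rows. Removing
the first column of a tableau of size `n + 1` leaves a tableau of size `n`, and conversely a new
first column may be filled in its bottom box and in the free rows only. Scanning the new column
from the bottom up to its first `α` or `γ`, one finds that a tableau with `r` free rows has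
extensions of total weight `2 (1 + z) (z + 2) ^ r`, where `z` marks free rows. So the generating
functions satisfy `G (n + 1) z = 2 (1 + z) G n (z + 2)`, whence `G n z = ∏ 2 (z + 2k - 1)` over
`k = 1, …, n` (`StaircaseTableau.sum_pow_r`). Divided by its value at `1`, this is the product of
the generating functions `1 + (z - 1) / (2k)` of the Bernoulli variables. At `z = exp (it)` this is
an identity of characteristic functions, and so of laws
(`IsIndepBernoulliFamily.identDistrib_r`); mean and variance follow by independence.

The central limit theorem is derived from Lévy's continuity theorem. With `w = exp (iθ) - 1`,
the characteristic function `∏ (1 + w / (2k))` at `θ` differs from `exp (w H_n / 2)` by `O(θ²)`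
uniformly in `n`, since all factors lie in the unit disc (`norm_prod_sub_exp_sum_le`). For
`L = log n / 2` and `θ = t / √L`, the exponent `w H_n / 2 - iθL` tends to `-t² / 2`, because
`H_n - log n` converges and `L (exp (iθ) - 1 - iθ) → -t² / 2` (`tendsto_sum_sub`).
-/

/-! ### Counting the fillings of one column -/

/-- The letter in a box (if any) is `α` or `γ`, so that all boxes above it must be empty. -/
def Greek.IsUp (x : Option Greek) : Prop := x = some Greek.α ∨ x = some Greek.γ

/-- The letter in a box (if any) is `β` or `δ`, so that all boxes to the left of it must be
empty. -/
def Greek.IsLeft (x : Option Greek) : Prop := x = some Greek.β ∨ x = some Greek.δ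

/-- The filling `c` of a column (from top to bottom) uses only the boxes in `F`, and all boxes
above an `α` or a `γ` are empty. -/
def ColumnAdmissible {m : ℕ} (F : Fin m → Prop) (c : Fin m → Option Greek) : Prop :=
  (∀ i, c i ≠ none → F i) ∧ ∀ i i', Greek.IsUp (c i) → i' < i → c i' = none

open Classical in
/-- The contribution of the column filling `c` to the generating function: `z` to the number of
rows in `F` that receive neither `β` nor `δ`, if `c` is admissible, and `0` otherwise. -/
noncomputable def columnWeight {R : Type*} [CommRing R] (z : R) {m : ℕ} (F : Fin m → Prop)
    (c : Fin m → Option Greek) : R :=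
  if ColumnAdmissible F c then z ^ Nat.card {i // F i ∧ ¬ Greek.IsLeft (c i)} else 0

lemma Fin.natCard_subtype_snoc {m : ℕ} (p : Fin (m + 1) → Prop) [Decidable (p (Fin.last m))] :
    Nat.card {i // p i} =
      Nat.card {i : Fin m // p i.castSucc} + if p (Fin.last m) then 1 else 0 := by
  classical
  simp only [Nat.card_eq_fintype_card, Fintype.card_subtype, Finset.card_filter,
    Fin.sum_univ_castSucc]
  congr

lemma columnAdmissible_snoc {m : ℕ} (F : Fin (m + 1) → Prop) (c : Fin m → Option Greek)
    (x : Option Greek) :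
    ColumnAdmissible F (Fin.snoc c x : Fin (m + 1) → Option Greek) ↔
      ColumnAdmissible (fun i => F i.castSucc) c ∧ (x ≠ none → F (Fin.last m)) ∧
        (Greek.IsUp x → c = fun _ => none) := by
  unfold ColumnAdmissible
  simp only [Fin.forall_fin_succ', Fin.snoc_castSucc, Fin.snoc_last, Fin.castSucc_lt_castSucc_iff,
    Fin.castSucc_lt_last, forall_true_left, IsEmpty.forall_iff, funext_iff,
    not_lt_of_ge (Fin.le_last _), implies_true, and_true]
  tauto

section

variable {R : Type*} [CommRing R] (z : R) {m : ℕ} (F : Fin (m + 1) → Prop)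

lemma columnWeight_snoc_none (c : Fin m → Option Greek) [Decidable (F (Fin.last m))] :
    columnWeight z F (Fin.snoc c none : Fin (m + 1) → Option Greek) =
      (if F (Fin.last m) then z else 1) * columnWeight z (fun i => F i.castSucc) c := by
  classical
  unfold columnWeight
  simp only [columnAdmissible_snoc, Fin.natCard_subtype_snoc, Fin.snoc_castSucc, Fin.snoc_last]
  by_cases h : ColumnAdmissible (fun i => F i.castSucc) c <;>
    by_cases h' : F (Fin.last m) <;> simp [h, h', Greek.IsUp, Greek.IsLeft, pow_succ, mul_comm]

lemma columnWeight_snoc_left (c : Fin m → Option Greek) {x : Option Greek} (hx : Greek.IsLeft x)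
    [Decidable (F (Fin.last m))] :
    columnWeight z F (Fin.snoc c x : Fin (m + 1) → Option Greek) =
      if F (Fin.last m) then columnWeight z (fun i => F i.castSucc) c else 0 := by
  classical
  unfold columnWeight
  simp only [columnAdmissible_snoc, Fin.natCard_subtype_snoc, Fin.snoc_castSucc, Fin.snoc_last]
  have hx1 : x ≠ none := by rcases hx with rfl | rfl <;> simp
  have hx2 : ¬ Greek.IsUp x := by rcases hx with rfl | rfl <;> simp [Greek.IsUp]
  by_cases h : ColumnAdmissible (fun i => F i.castSucc) c <;>
    by_cases h' : F (Fin.last m) <;> simp [h, h', hx, hx1, hx2]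

/-- A letter `α` or `γ` at the bottom of a column forces all other boxes to be empty. -/
lemma sum_columnWeight_snoc_up {x : Option Greek} (hx : Greek.IsUp x)
    [Decidable (F (Fin.last m))] :
    ∑ c : Fin m → Option Greek, columnWeight z F (Fin.snoc c x : Fin (m + 1) → Option Greek) =
      if F (Fin.last m) then z ^ (Nat.card {i : Fin m // F i.castSucc} + 1) else 0 := by
  classical
  have hx1 : x ≠ none := by rcases hx with rfl | rfl <;> simp
  have hx2 : ¬ Greek.IsLeft x := by rcases hx with rfl | rfl <;> simp [Greek.IsLeft]
  rw [Finset.sum_eq_single (fun _ => none)]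
  · unfold columnWeight
    simp only [columnAdmissible_snoc, Fin.natCard_subtype_snoc, Fin.snoc_castSucc, Fin.snoc_last]
    by_cases h' : F (Fin.last m) <;>
      simp [h', hx, hx1, hx2, ColumnAdmissible, show ¬ Greek.IsLeft none by simp [Greek.IsLeft]]
  · intro c _ hc
    simp [columnWeight, columnAdmissible_snoc, hx, hc]
  · simp

lemma sum_snoc_option_greek (f : (Fin (m + 1) → Option Greek) → R) :
    ∑ c, f c = ∑ c : Fin m → Option Greek, f (Fin.snoc c none : Fin (m + 1) → Option Greek) +
      (∑ c : Fin m → Option Greek, f (Fin.snoc c (some .α) : Fin (m + 1) → Option Greek) +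
      ∑ c : Fin m → Option Greek, f (Fin.snoc c (some .γ) : Fin (m + 1) → Option Greek) +
      ∑ c : Fin m → Option Greek, f (Fin.snoc c (some .β) : Fin (m + 1) → Option Greek) +
      ∑ c : Fin m → Option Greek, f (Fin.snoc c (some .δ) : Fin (m + 1) → Option Greek)) := by
  rw [← (Fin.snocEquiv fun _ => Option Greek).sum_comp, Fintype.sum_prod_type,
    Fintype.sum_option]
  have : ∀ g : Greek → R, ∑ x, g x = g .α + g .γ + g .β + g .δ := by
    intro g
    have : (Finset.univ : Finset Greek) = {.α, .γ, .β, .δ} := by decide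
    rw [this]
    simp [add_assoc]
  rw [this]
  rfl

end

/-- Scanning the column from the bottom: an available box may be empty, or carry one of two
letters `β`, `δ`, or one of two letters `α`, `γ` that end the scan. With `r` boxes available this
gives the recursion `W (r + 1) = (z + 2) W r + 2 z ^ (r + 1)`, solved by
`W r = (1 + z) (z + 2) ^ r - z ^ (r + 1)`. -/
lemma sum_columnWeight {R : Type*} [CommRing R] (z : R) {m : ℕ} (F : Fin m → Prop) :
    ∑ c, columnWeight z F c + z ^ (Nat.card {i // F i} + 1) =
      (1 + z) * (z + 2) ^ Nat.card {i // F i} := by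
  classical
  induction m with
  | zero => simp [columnWeight, ColumnAdmissible]
  | succ m ih =>
    have ih := ih fun i => F i.castSucc
    rw [sum_snoc_option_greek, sum_columnWeight_snoc_up z F (.inl rfl),
      sum_columnWeight_snoc_up z F (.inr rfl), Fin.natCard_subtype_snoc]
    simp only [columnWeight_snoc_none, columnWeight_snoc_left z F _ (.inl rfl),
      columnWeight_snoc_left z F _ (.inr rfl), ← Finset.mul_sum]
    by_cases h : F (Fin.last m)
    · simp only [h, if_true]
      linear_combination (z + 2) * ih
    · simp only [h, if_false, Finset.sum_const_zero]
      linear_combination ih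

/-- The possible first columns to the left of a tableau: the bottom box is new, and nonempty. -/
lemma sum_columnWeight_of_last_ne_none {R : Type*} [CommRing R] (z : R) {m : ℕ}
    (F : Fin (m + 1) → Prop) (hF : F (Fin.last m)) :
    ∑ c : Fin (m + 1) → Option Greek,
        (if c (Fin.last m) ≠ none then columnWeight z F c else 0) =
      2 * (1 + z) * (z + 2) ^ Nat.card {i : Fin m // F i.castSucc} := by
  classical
  have h := sum_columnWeight z fun i => F i.castSucc
  rw [sum_snoc_option_greek]
  simp only [Fin.snoc_last, ne_eq, not_true_eq_false, if_false, reduceCtorEq, not_false_eq_true,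
    if_true, sum_columnWeight_snoc_up z F (.inl rfl), sum_columnWeight_snoc_up z F (.inr rfl),
    columnWeight_snoc_left z F _ (.inl rfl), columnWeight_snoc_left z F _ (.inr rfl), hF,
    Finset.sum_const_zero]
  linear_combination 2 * h

/-! ### Removing the first column of a tableau -/

namespace StaircaseTableau

variable {n : ℕ}

/-- No box of row `i` contains a `β` or a `δ`. -/
def FreeRow (S : StaircaseTableau n) (i : Fin n) : Prop :=
  ∀ j, ¬ Greek.IsLeft (S.entry i j)

/-- Everything to the left of a `β` or `δ` is empty, so a row contains such a letter exactly if
its leftmost entry is one; and every row has a leftmost entry, as its diagonal box is nonempty. -/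
lemma indexedBy_iff_freeRow (S : StaircaseTableau n) (i : Fin n) :
    S.IndexedBy i {Greek.α, Greek.γ} ↔ S.FreeRow i := by
  classical
  constructor
  · rintro ⟨j, x, hx, hleft, hmem⟩ k hk
    rcases lt_trichotomy k j with h | rfl | h
    · simp [Greek.IsLeft, hleft k h] at hk
    · rw [hx] at hk
      rcases hmem with rfl | rfl <;> simp [Greek.IsLeft] at hk
    · simp [S.left_empty i k j hk h] at hx
  · intro h
    obtain ⟨j, hj, hmin⟩ := WellFounded.has_min (wellFounded_lt (α := Fin n))
      {j | S.entry i j ≠ none} ⟨⟨n - 1 - i, by omega⟩, S.diagonal _ _ (by simp only; omega)⟩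
    obtain ⟨x, hx⟩ := Option.ne_none_iff_exists'.1 hj
    refine ⟨j, x, hx, fun k hk => ?_, ?_⟩
    · by_contra hne
      exact hmin k hne hk
    · have := h j
      rw [hx] at this
      cases x <;> simp_all [Greek.IsLeft]

lemma r_eq_natCard (S : StaircaseTableau n) : S.r = Nat.card {i // S.FreeRow i} := by
  simp only [r, indexedBy_iff_freeRow]
  rfl

/-- The tableau that remains when the first column is removed; its last row, which then has no
box, is removed as well. -/
def tail (S : StaircaseTableau (n + 1)) : StaircaseTableau n where
  entry i j := S.entry i.castSucc j.succ
  outside i j h := S.outside _ _ (by simp only [Fin.val_castSucc, Fin.val_succ]; omega)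
  diagonal i j h := S.diagonal _ _ (by simp only [Fin.val_castSucc, Fin.val_succ]; omega)
  left_empty i j j' h hlt := S.left_empty _ _ _ h (by simpa using hlt)
  above_empty i i' j h hlt := S.above_empty _ _ _ h (by simpa using hlt)

/-- The rows in which a new first column may have a nonempty box: the free rows of the tableau,
and the new row at the bottom. -/
def Available (S : StaircaseTableau n) (i : Fin (n + 1)) : Prop :=
  ∀ h : i ≠ Fin.last n, S.FreeRow (i.castPred h)

@[simp] lemma available_castSucc (S : StaircaseTableau n) (i : Fin n) :
    S.Available i.castSucc ↔ S.FreeRow i := by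
  simp [Available, Fin.castSucc_ne_last]

@[simp] lemma available_last (S : StaircaseTableau n) : S.Available (Fin.last n) := by
  simp [Available]

lemma entry_last_succ (S : StaircaseTableau (n + 1)) (j : Fin n) :
    S.entry (Fin.last n) j.succ = none :=
  S.outside _ _ (by simp only [Fin.val_last, Fin.val_succ]; omega)

lemma freeRow_iff (S : StaircaseTableau (n + 1)) (i : Fin (n + 1)) :
    S.FreeRow i ↔ S.tail.Available i ∧ ¬ Greek.IsLeft (S.entry i 0) := by
  cases i using Fin.lastCases with
  | last =>
    simp [FreeRow, Fin.forall_fin_succ (n := n), entry_last_succ, Greek.IsLeft]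
  | cast i =>
    rw [available_castSucc]
    simp only [FreeRow, Fin.forall_fin_succ (n := n), tail]
    tauto

lemma columnAdmissible_tail (S : StaircaseTableau (n + 1)) :
    ColumnAdmissible S.tail.Available fun i => S.entry i 0 := by
  refine ⟨fun i hi => ?_, fun i i' h hlt => S.above_empty _ _ _ h hlt⟩
  cases i using Fin.lastCases with
  | last => simp
  | cast i =>
    rw [available_castSucc]
    exact fun j hj => hi (S.left_empty _ j.succ _ hj (Fin.succ_pos j))

/-- The tableau obtained by putting the column `c` to the left of `S`. -/
def cons (S : StaircaseTableau n) (c : Fin (n + 1) → Option Greek)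
    (hc : ColumnAdmissible S.Available c) (hlast : c (Fin.last n) ≠ none) :
    StaircaseTableau (n + 1) where
  entry i j := Fin.cases (c i)
    (fun j' => Fin.lastCases (motive := fun _ => Option Greek) none (fun i' => S.entry i' j') i) j
  outside i j h := by
    cases j using Fin.cases with
    | zero => simp only [Fin.val_zero] at h; omega
    | succ j =>
      cases i using Fin.lastCases with
      | last => simp
      | cast i =>
        simp only [Fin.cases_succ, Fin.lastCases_castSucc]
        exact S.outside _ _ (by simp only [Fin.val_castSucc, Fin.val_succ] at h; omega)
  diagonal i j h := by
    cases j using Fin.cases with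
    | zero =>
      have : i = Fin.last n := Fin.ext (by simpa using h)
      simpa [this] using hlast
    | succ j =>
      cases i using Fin.lastCases with
      | last => simp only [Fin.val_last, Fin.val_succ] at h; omega
      | cast i =>
        simp only [Fin.cases_succ, Fin.lastCases_castSucc]
        exact S.diagonal _ _ (by simp only [Fin.val_castSucc, Fin.val_succ] at h; omega)
  left_empty i j j' h hlt := by
    cases j using Fin.cases with
    | zero => simp at hlt
    | succ j =>
      cases i using Fin.lastCases with
      | last => simp at h
      | cast i =>
        simp only [Fin.cases_succ, Fin.lastCases_castSucc] at h
        cases j' using Fin.cases with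
        | zero =>
          by_contra hne
          exact (S.available_castSucc i).1 (hc.1 _ hne) j h
        | succ j' =>
          simp only [Fin.cases_succ, Fin.lastCases_castSucc]
          exact S.left_empty i j j' h (by simpa using hlt)
  above_empty i i' j h hlt := by
    cases j using Fin.cases with
    | zero => exact hc.2 i i' h hlt
    | succ j =>
      cases i using Fin.lastCases with
      | last => simp at h
      | cast i =>
        simp only [Fin.cases_succ, Fin.lastCases_castSucc] at h ⊢
        cases i' using Fin.lastCases with
        | last => exact absurd hlt (not_lt_of_ge (Fin.le_last _))
        | cast i' =>
          simp only [Fin.lastCases_castSucc]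
          exact S.above_empty i i' j h (by simpa using hlt)

/-- A tableau of size `n + 1` is a tableau of size `n` together with a first column. -/
def consEquiv (n : ℕ) : StaircaseTableau (n + 1) ≃
    (S : StaircaseTableau n) × {c : Fin (n + 1) → Option Greek //
      ColumnAdmissible S.Available c ∧ c (Fin.last n) ≠ none} where
  toFun S := ⟨S.tail, fun i => S.entry i 0, S.columnAdmissible_tail, S.diagonal _ _ (by simp)⟩
  invFun p := p.1.cons p.2.1 p.2.2.1 p.2.2.2
  left_inv S := by
    ext1
    funext i j
    cases j using Fin.cases with
    | zero => rfl
    | succ j =>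
      cases i using Fin.lastCases with
      | last => simp [cons, entry_last_succ]
      | cast i => simp [cons, tail]
  right_inv p := by
    obtain ⟨S, c, hc⟩ := p
    have : (S.cons c hc.1 hc.2).tail = S := by
      ext1
      funext i j
      simp [cons, tail]
    ext1
    · exact this
    · rfl

/-! ### The generating function of `r` -/

noncomputable instance instFintype (n : ℕ) : Fintype (StaircaseTableau n) := Fintype.ofFinite _

/-- Adding a first column to a tableau with `r` free rows contributes `2(1+z)(z+2)^r`. -/
lemma sum_pow_r_succ {R : Type*} [CommRing R] (z : R) (n : ℕ) :
    ∑ S : StaircaseTableau (n + 1), z ^ S.r =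
      2 * (1 + z) * ∑ S : StaircaseTableau n, (z + 2) ^ S.r := by
  classical
  rw [← (consEquiv n).symm.sum_comp, Fintype.sum_sigma, Finset.mul_sum]
  refine Finset.sum_congr rfl fun S _ => ?_
  have h := sum_columnWeight_of_last_ne_none z S.Available S.available_last
  simp only [available_castSucc] at h
  rw [r_eq_natCard S, ← h]
  have hw : ∀ c : {c : Fin (n + 1) → Option Greek //
      ColumnAdmissible S.Available c ∧ c (Fin.last n) ≠ none},
      z ^ ((consEquiv n).symm ⟨S, c⟩).r = columnWeight z S.Available c := by
    intro c
    rw [r_eq_natCard, columnWeight, if_pos c.2.1]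
    set T := (consEquiv n).symm ⟨S, c⟩ with hT
    have hT' : consEquiv n T = ⟨S, c⟩ := by simp [hT]
    have h1 : T.tail = S := congrArg Sigma.fst hT'
    simp only [freeRow_iff, h1]
    rfl
  simp only [hw]
  rw [← Finset.sum_subtype (Finset.univ.filter fun c : Fin (n + 1) → Option Greek =>
      ColumnAdmissible S.Available c ∧ c (Fin.last n) ≠ none) (by simp)
      (columnWeight z S.Available), Finset.sum_filter]
  refine Finset.sum_congr rfl fun c _ => ?_
  by_cases h1 : ColumnAdmissible S.Available c <;> by_cases h2 : c (Fin.last n) = none <;>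
    simp [h1, h2, columnWeight]

theorem sum_pow_r {R : Type*} [CommRing R] (z : R) (n : ℕ) :
    ∑ S : StaircaseTableau n, z ^ S.r = ∏ k ∈ Finset.range n, 2 * (z + 2 * k + 1) := by
  induction n generalizing z with
  | zero =>
    have : Subsingleton (StaircaseTableau 0) := ⟨fun S T => by ext1; funext i; exact i.elim0⟩
    obtain ⟨S⟩ := instNonempty 0
    rw [Fintype.sum_subsingleton _ S]
    simp [r_eq_natCard]
  | succ n ih =>
    rw [sum_pow_r_succ, ih, Finset.prod_range_succ', mul_comm]
    congr 1
    · refine Finset.prod_congr rfl fun k _ => ?_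
      push_cast
      ring
    · push_cast
      ring

end StaircaseTableau

/-! ### Equality in law -/

namespace StaircaseTableau

lemma integral_tableauMeasure {E : Type*} [NormedAddCommGroup E] [NormedSpace ℝ E]
    [CompleteSpace E] (n : ℕ) (f : StaircaseTableau n → E) :
    ∫ S, f S ∂(tableauMeasure n) =
      (Fintype.card (StaircaseTableau n) : ℝ)⁻¹ • ∑ S, f S := by
  classical
  rw [integral_fintype .of_finite, Finset.smul_sum]
  refine Finset.sum_congr rfl fun S _ => ?_
  rw [tableauMeasure, measureReal_def, uniformOn_univ]
  simp

/-- The characteristic function of `r` is the product of those of the Bernoulli variables. -/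
lemma charFun_r (n : ℕ) (t : ℝ) :
    charFun ((tableauMeasure n).map fun S => (S.r : ℝ)) t =
      ∏ k ∈ Finset.range n,
        (1 + (Complex.exp (t * Complex.I) - 1) / (2 * ((k : ℂ) + 1))) := by
  have hcard : ((Fintype.card (StaircaseTableau n) : ℝ) : ℂ) =
      ∏ k ∈ Finset.range n, 2 * (1 + 2 * (k : ℂ) + 1) := by
    rw [← sum_pow_r (1 : ℂ) n]
    simp
  rw [charFun_apply_real, integral_map (by fun_prop) (by fun_prop), integral_tableauMeasure,
    Complex.real_smul, Complex.ofReal_inv, hcard]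
  have h : ∀ S : StaircaseTableau n,
      Complex.exp (t * ((S.r : ℝ) : ℂ) * Complex.I) = Complex.exp (t * Complex.I) ^ S.r := by
    intro S
    rw [← Complex.exp_nat_mul]
    push_cast
    ring_nf
  simp only [h]
  rw [sum_pow_r, ← Finset.prod_inv_distrib, ← Finset.prod_mul_distrib]
  refine Finset.prod_congr rfl fun k _ => ?_
  have hk : (k : ℂ) + 1 ≠ 0 := by exact_mod_cast Nat.succ_ne_zero k
  have hk' : 1 + 2 * (k : ℂ) + 1 ≠ 0 := by
    rw [show 1 + 2 * (k : ℂ) + 1 = 2 * (k + 1) by ring]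
    exact mul_ne_zero two_ne_zero hk
  field_simp
  ring

end StaircaseTableau

namespace IsIndepBernoulliFamily

variable {n : ℕ} {Ω : Type*} [MeasurableSpace Ω] {P : Measure Ω} {J : Fin n → Ω → ℕ}

lemma measurable_cast (h : IsIndepBernoulliFamily n P J) (i : Fin n) :
    Measurable fun ω => (J i ω : ℝ) :=
  measurable_from_nat.comp (h.measurable i)

lemma iIndepFun_cast (h : IsIndepBernoulliFamily n P J) :
    iIndepFun (fun i ω => (J i ω : ℝ)) P :=
  h.indep.comp (fun _ (k : ℕ) => (k : ℝ)) fun _ => measurable_from_nat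

lemma prob_mem_Icc (i : ℕ) :
    0 ≤ 1 / (2 * ((i : ℝ) + 1)) ∧ 1 / (2 * ((i : ℝ) + 1)) ≤ 1 := by
  have : (0 : ℝ) ≤ i := Nat.cast_nonneg i
  constructor
  · positivity
  · rw [div_le_one (by positivity)]
    linarith

variable [IsProbabilityMeasure P]

lemma ae_eq_one_or_eq_zero (h : IsIndepBernoulliFamily n P J) (i : Fin n) :
    ∀ᵐ ω ∂P, J i ω = 1 ∨ J i ω = 0 := by
  have m1 : MeasurableSet {ω | J i ω = 1} := h.measurable i (measurableSet_singleton 1)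
  have m0 : MeasurableSet {ω | J i ω = 0} := h.measurable i (measurableSet_singleton 0)
  change {ω | J i ω = 1} ∪ {ω | J i ω = 0} ∈ ae P
  have hp := prob_mem_Icc i
  rw [mem_ae_iff_prob_eq_one (m1.union m0), measure_union _ m0, h.prob_one, h.prob_zero,
    ← ENNReal.ofReal_add hp.1 (by linarith [hp.2])]
  · simp
  · rw [Set.disjoint_left]
    intro ω h1 h0
    simp_all

lemma integral_comp {E : Type*} [NormedAddCommGroup E] [NormedSpace ℝ E] [CompleteSpace E]
    (h : IsIndepBernoulliFamily n P J) (i : Fin n) (f : ℕ → E) :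
    ∫ ω, f (J i ω) ∂P =
      (1 / (2 * ((i : ℝ) + 1))) • f 1 + (1 - 1 / (2 * ((i : ℝ) + 1))) • f 0 := by
  have m1 : MeasurableSet {ω | J i ω = 1} := h.measurable i (measurableSet_singleton 1)
  have m0 : MeasurableSet {ω | J i ω = 0} := h.measurable i (measurableSet_singleton 0)
  have hp := prob_mem_Icc i
  have hfun : (fun ω => f (J i ω)) =ᵐ[P] fun ω =>
      {ω | J i ω = 1}.indicator (fun _ => f 1) ω +
        {ω | J i ω = 0}.indicator (fun _ => f 0) ω := by
    filter_upwards [h.ae_eq_one_or_eq_zero i] with ω hω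
    rcases hω with h | h <;> simp [h]
  rw [integral_congr_ae hfun, integral_add ((integrable_const _).indicator m1)
    ((integrable_const _).indicator m0), integral_indicator_const _ m1,
    integral_indicator_const _ m0, measureReal_def, measureReal_def, h.prob_one, h.prob_zero,
    ENNReal.toReal_ofReal hp.1, ENNReal.toReal_ofReal (by linarith [hp.2])]

lemma memLp_cast (h : IsIndepBernoulliFamily n P J) (i : Fin n) :
    MemLp (fun ω => (J i ω : ℝ)) 2 P := by
  refine MemLp.of_bound (h.measurable_cast i).aestronglyMeasurable 1 ?_
  filter_upwards [h.ae_eq_one_or_eq_zero i] with ω hω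
  rcases hω with h | h <;> simp [h]

lemma integral_cast (h : IsIndepBernoulliFamily n P J) (i : Fin n) :
    ∫ ω, (J i ω : ℝ) ∂P = 1 / (2 * ((i : ℝ) + 1)) := by
  simpa using h.integral_comp i fun k : ℕ => (k : ℝ)

lemma variance_cast (h : IsIndepBernoulliFamily n P J) (i : Fin n) :
    variance (fun ω => (J i ω : ℝ)) P =
      1 / (2 * ((i : ℝ) + 1)) * (1 - 1 / (2 * ((i : ℝ) + 1))) := by
  have h2 : ∫ ω, (J i ω : ℝ) ^ 2 ∂P = 1 / (2 * ((i : ℝ) + 1)) := by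
    rw [h.integral_comp i fun k : ℕ => (k : ℝ) ^ 2]
    norm_num
  rw [variance_eq_sub (h.memLp_cast i), h.integral_cast]
  simp only [Pi.pow_apply]
  rw [h2]
  ring

lemma charFun_map (h : IsIndepBernoulliFamily n P J) (i : Fin n) (t : ℝ) :
    charFun (P.map fun ω => (J i ω : ℝ)) t =
      1 + (Complex.exp (t * Complex.I) - 1) / (2 * ((i : ℂ) + 1)) := by
  rw [charFun_apply_real, integral_map (h.measurable_cast i).aemeasurable (by fun_prop)]
  have hi : (i : ℂ) + 1 ≠ 0 := by exact_mod_cast Nat.succ_ne_zero i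
  simp only [Complex.ofReal_natCast]
  rw [h.integral_comp i fun k : ℕ => Complex.exp (t * (k : ℂ) * Complex.I)]
  simp only [Complex.real_smul]
  push_cast
  simp only [mul_zero, mul_one, zero_mul, Complex.exp_zero]
  field_simp
  ring

/-- The real-valued laws agree because their characteristic functions do; the laws on `ℕ` are
recovered as preimages under the measurable embedding `ℕ → ℝ`. -/
lemma identDistrib_r (h : IsIndepBernoulliFamily n P J) :
    IdentDistrib (fun S : StaircaseTableau n => S.r) (fun ω => ∑ i, J i ω)
      (tableauMeasure n) P := by
  have hJ : Measurable fun ω => ∑ i, J i ω := Finset.measurable_sum _ fun i _ => h.measurable i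
  have hr : Measurable fun S : StaircaseTableau n => S.r := .of_discrete
  have hcast : Measurable fun k : ℕ => (k : ℝ) := measurable_from_nat
  refine ⟨hr.aemeasurable, hJ.aemeasurable, ?_⟩
  have key : (tableauMeasure n).map (fun S => (S.r : ℝ)) =
      P.map fun ω => ((∑ i, J i ω : ℕ) : ℝ) := by
    have : IsProbabilityMeasure ((tableauMeasure n).map fun S => (S.r : ℝ)) :=
      Measure.isProbabilityMeasure_map (hcast.comp hr).aemeasurable
    have : IsProbabilityMeasure (P.map fun ω => ((∑ i, J i ω : ℕ) : ℝ)) :=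
      Measure.isProbabilityMeasure_map (hcast.comp hJ).aemeasurable
    refine Measure.ext_of_charFun ?_
    funext t
    simp only [Nat.cast_sum]
    rw [h.iIndepFun_cast.charFun_map_fun_sum_eq_prod fun i => (h.measurable_cast i).aemeasurable,
      StaircaseTableau.charFun_r, Finset.prod_apply, Finset.prod_range]
    exact Finset.prod_congr rfl fun i _ => (h.charFun_map i t).symm
  have hemb : MeasurableEmbedding fun k : ℕ => (k : ℝ) := .natCast
  have key' : ((tableauMeasure n).map fun S => S.r).map (fun k : ℕ => (k : ℝ)) =
      (P.map fun ω => ∑ i, J i ω).map fun k : ℕ => (k : ℝ) := by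
    rwa [Measure.map_map hcast hr, Measure.map_map hcast hJ]
  rw [← hemb.comap_map ((tableauMeasure n).map fun S => S.r), key', hemb.comap_map]

end IsIndepBernoulliFamily

/-- Under the product of `n` two-point laws on `ℕ`, the coordinates are independent Bernoulli
variables of the required parameters. -/
lemma exists_isIndepBernoulliFamily (n : ℕ) :
    ∃ (Ω : Type) (_ : MeasurableSpace Ω) (P : Measure Ω) (J : Fin n → Ω → ℕ),
      IsProbabilityMeasure P ∧ IsIndepBernoulliFamily n P J := by
  let p : Fin n → ℝ := fun i => 1 / (2 * ((i : ℝ) + 1))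
  let ν : Fin n → Measure ℕ := fun i =>
    ENNReal.ofReal (p i) • Measure.dirac 1 + ENNReal.ofReal (1 - p i) • Measure.dirac 0
  have hp : ∀ i, 0 ≤ p i ∧ p i ≤ 1 := fun i => IsIndepBernoulliFamily.prob_mem_Icc i
  have hν : ∀ i, IsProbabilityMeasure (ν i) := fun i => ⟨by
    simp only [ν, Measure.add_apply, Measure.smul_apply, measure_univ, smul_eq_mul, mul_one]
    rw [← ENNReal.ofReal_add (hp i).1 (by linarith [(hp i).2])]
    simp⟩
  have hlaw : ∀ i k, Measure.pi ν {ω | ω i = k} = ν i {k} := fun i k => by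
    rw [← (measurePreserving_eval ν i).measure_preimage
      (measurableSet_singleton k).nullMeasurableSet]
    rfl
  refine ⟨Fin n → ℕ, inferInstance, Measure.pi ν, fun i ω => ω i, inferInstance,
    fun i => measurable_pi_apply i, iIndepFun_pi (X := fun _ => id) fun i => aemeasurable_id,
    fun i => ?_, fun i => ?_⟩
  · rw [hlaw]
    simp [ν, p]
  · rw [hlaw]
    simp [ν, p]

/-! ### Expected value and variance -/

namespace StaircaseTableau

lemma sum_fin_eq_sum_Icc (n : ℕ) (f : ℝ → ℝ) :
    ∑ i : Fin n, f ((i : ℝ) + 1) = ∑ k ∈ Finset.Icc 1 n, f k := by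
  rw [← Finset.sum_range fun i : ℕ => f ((i : ℝ) + 1), ← Finset.Ico_add_one_right_eq_Icc,
    Finset.sum_Ico_eq_sum_range]
  refine Finset.sum_congr rfl fun k _ => ?_
  push_cast
  rw [add_comm]

lemma integral_r (n : ℕ) :
    ∫ S : StaircaseTableau n, (S.r : ℝ) ∂(tableauMeasure n) =
      ∑ k ∈ Finset.Icc 1 n, 1 / (2 * (k : ℝ)) := by
  obtain ⟨Ω, _, P, J, _, h⟩ := exists_isIndepBernoulliFamily n
  have hid := h.identDistrib_r.comp (u := fun k : ℕ => (k : ℝ)) measurable_from_nat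
  have hE := hid.integral_eq
  simp only [Function.comp_def, Nat.cast_sum] at hE
  rw [hE, integral_finsetSum _ fun i _ => (h.memLp_cast i).integrable one_le_two]
  simp only [h.integral_cast]
  exact sum_fin_eq_sum_Icc n fun x => 1 / (2 * x)

lemma variance_r (n : ℕ) :
    variance (fun S : StaircaseTableau n => (S.r : ℝ)) (tableauMeasure n) =
      ∑ k ∈ Finset.Icc 1 n, 1 / (2 * (k : ℝ)) * (1 - 1 / (2 * (k : ℝ))) := by
  obtain ⟨Ω, _, P, J, _, h⟩ := exists_isIndepBernoulliFamily n
  have hid := h.identDistrib_r.comp (u := fun k : ℕ => (k : ℝ)) measurable_from_nat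
  have hV := hid.variance_eq
  simp only [Function.comp_def, Nat.cast_sum] at hV
  have hsum : (fun ω => ∑ i, (J i ω : ℝ)) = ∑ i, fun ω => (J i ω : ℝ) := by
    ext ω
    simp
  rw [hV, hsum, IndepFun.variance_sum (fun i _ => h.memLp_cast i)
    fun i _ j _ hij => h.iIndepFun_cast.indepFun hij]
  simp only [h.variance_cast]
  exact sum_fin_eq_sum_Icc n fun x => 1 / (2 * x) * (1 - 1 / (2 * x))

end StaircaseTableau

/-! ### The central limit theorem -/

lemma norm_prod_sub_prod_le {ι : Type*} (s : Finset ι) (a b : ι → ℂ) (ha : ∀ i ∈ s, ‖a i‖ ≤ 1)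
    (hb : ∀ i ∈ s, ‖b i‖ ≤ 1) :
    ‖∏ i ∈ s, a i - ∏ i ∈ s, b i‖ ≤ ∑ i ∈ s, ‖a i - b i‖ := by
  classical
  induction s using Finset.induction_on with
  | empty => simp
  | insert j s hj ih =>
    rw [Finset.prod_insert hj, Finset.prod_insert hj, Finset.sum_insert hj]
    have ha' : ∀ i ∈ s, ‖a i‖ ≤ 1 := fun i hi => ha i (Finset.mem_insert_of_mem hi)
    have hb' : ∀ i ∈ s, ‖b i‖ ≤ 1 := fun i hi => hb i (Finset.mem_insert_of_mem hi)
    have h1 : ‖∏ i ∈ s, a i‖ ≤ 1 :=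
      (Finset.norm_prod_le _ _).trans (Finset.prod_le_one (fun _ _ => norm_nonneg _) ha')
    calc ‖a j * ∏ i ∈ s, a i - b j * ∏ i ∈ s, b i‖
        = ‖(a j - b j) * ∏ i ∈ s, a i + b j * (∏ i ∈ s, a i - ∏ i ∈ s, b i)‖ := by
          congr 1
          ring
      _ ≤ ‖a j - b j‖ * ‖∏ i ∈ s, a i‖ + ‖b j‖ * ‖∏ i ∈ s, a i - ∏ i ∈ s, b i‖ := by
          rw [← norm_mul, ← norm_mul]
          exact norm_add_le _ _
      _ ≤ ‖a j - b j‖ * 1 + 1 * ∑ i ∈ s, ‖a i - b i‖ := by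
          gcongr
          · exact hb j (Finset.mem_insert_self _ _)
          · exact ih ha' hb'
      _ = _ := by ring

lemma norm_exp_mul_I_sub_one_le (θ : ℝ) : ‖Complex.exp (θ * Complex.I) - 1‖ ≤ |θ| := by
  rw [mul_comm]
  exact Real.norm_exp_I_mul_ofReal_sub_one_le

/-- The characteristic function `∏ (1 + x_k)` of `r` is uniformly close to `exp (∑ x_k)`, the
characteristic function of a Poisson variable of the same mean. -/
lemma norm_prod_sub_exp_sum_le (n : ℕ) (θ : ℝ) :
    ‖∏ k ∈ Finset.range n, (1 + (Complex.exp (θ * Complex.I) - 1) / (2 * ((k : ℂ) + 1))) -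
        Complex.exp (∑ k ∈ Finset.range n,
          (Complex.exp (θ * Complex.I) - 1) / (2 * ((k : ℂ) + 1)))‖ ≤
      θ ^ 2 * ∑' k : ℕ, 1 / ((k : ℝ) + 1) ^ 2 := by
  set w := Complex.exp (θ * Complex.I) - 1 with hw
  have hwθ : ‖w‖ ≤ |θ| := norm_exp_mul_I_sub_one_le θ
  have hw2 : ‖w‖ ≤ 2 := by
    refine (norm_sub_le _ _).trans ?_
    rw [Complex.norm_exp_ofReal_mul_I]
    norm_num
  have hcast : ∀ k : ℕ, (2 * ((k : ℂ) + 1)) = ((2 * ((k : ℝ) + 1) : ℝ) : ℂ) := fun k => by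
    push_cast
    rfl
  have hnorm : ∀ k : ℕ, ‖w / (2 * ((k : ℂ) + 1))‖ = ‖w‖ / (2 * ((k : ℝ) + 1)) := fun k => by
    rw [hcast, norm_div, Complex.norm_of_nonneg (by positivity)]
  have hsum : Summable fun k : ℕ => 1 / ((k : ℝ) + 1) ^ 2 := by
    have := (summable_nat_add_iff 1).2 (Real.summable_one_div_nat_pow.2 one_lt_two)
    simpa using this
  rw [Complex.exp_sum]
  refine (norm_prod_sub_prod_le _ _ _ (fun k _ => ?_) fun k _ => ?_).trans ?_
  · -- a convex combination of two points of the unit circle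
    have hp := IsIndepBernoulliFamily.prob_mem_Icc k
    have h1 : 1 + w / (2 * ((k : ℂ) + 1)) =
        ((1 - 1 / (2 * ((k : ℝ) + 1)) : ℝ) : ℂ) +
          ((1 / (2 * ((k : ℝ) + 1)) : ℝ) : ℂ) * Complex.exp (θ * Complex.I) := by
      rw [hw]
      push_cast
      ring
    rw [h1]
    refine (norm_add_le _ _).trans ?_
    rw [norm_mul, Complex.norm_exp_ofReal_mul_I, Complex.norm_of_nonneg (by linarith [hp.2]),
      Complex.norm_of_nonneg hp.1]
    linarith
  · rw [Complex.norm_exp, Real.exp_le_one_iff, hcast, Complex.div_ofReal_re]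
    refine div_nonpos_of_nonpos_of_nonneg ?_ (by positivity)
    rw [hw, Complex.sub_re, Complex.exp_ofReal_mul_I_re, Complex.one_re]
    linarith [Real.cos_le_one θ]
  · refine le_trans (Finset.sum_le_sum fun k _ => ?_)
      ((Finset.mul_sum _ _ _).symm.le.trans (mul_le_mul_of_nonneg_left
        (hsum.sum_le_tsum (Finset.range n) fun k _ => by positivity) (sq_nonneg θ)))
    rw [norm_sub_rev, ← sub_sub]
    refine (Complex.norm_exp_sub_one_sub_id_le ?_).trans ?_
    · rw [hnorm, div_le_one (by positivity)]
      have : (0 : ℝ) ≤ k := Nat.cast_nonneg k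
      linarith
    · rw [hnorm, div_pow, ← mul_one_div, ← sq_abs θ]
      gcongr
      linarith [Nat.cast_nonneg (α := ℝ) k]

/-- The third-order remainder of `exp` on the imaginary axis. -/
lemma norm_exp_mul_I_sub_le {θ : ℝ} (hθ : |θ| ≤ 1) :
    ‖Complex.exp (θ * Complex.I) - 1 - θ * Complex.I + (θ : ℂ) ^ 2 / 2‖ ≤ |θ| ^ 3 := by
  have hn : ‖(θ : ℂ) * Complex.I‖ = |θ| := by simp
  have h := Complex.exp_bound (x := θ * Complex.I) (by rwa [hn]) (n := 3) (by norm_num)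
  rw [hn] at h
  have he : Complex.exp (θ * Complex.I) - 1 - θ * Complex.I + (θ : ℂ) ^ 2 / 2 =
      Complex.exp (θ * Complex.I) -
        ∑ m ∈ Finset.range 3, ((θ : ℂ) * Complex.I) ^ m / (m.factorial : ℂ) := by
    simp only [Finset.sum_range_succ, Finset.sum_range_zero, Nat.factorial, mul_pow,
      Complex.I_sq]
    push_cast
    ring
  rw [he]
  refine h.trans (mul_le_of_le_one_right (by positivity) ?_)
  norm_num [Nat.factorial]

/-- The logarithm of the Poisson approximation, centred at `L θ`, with `L = log n / 2` and
`θ = t / √L`: the difference `H_n - log n` is bounded, and `L (exp (iθ) - 1 - iθ)` tends to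
`-t² / 2`. -/
lemma tendsto_sum_sub (t : ℝ) (L θ : ℕ → ℝ) (hL : ∀ n, L n = Real.log n / 2)
    (hθ : Tendsto θ atTop (nhds 0)) (hLθ : ∀ᶠ n in atTop, L n * θ n ^ 2 = t ^ 2) :
    Tendsto (fun n : ℕ => ∑ k ∈ Finset.range n,
        (Complex.exp (θ n * Complex.I) - 1) / (2 * ((k : ℂ) + 1)) - L n * (θ n * Complex.I))
      atTop (nhds (-(t : ℂ) ^ 2 / 2)) := by
  have hw : Tendsto (fun n => Complex.exp (θ n * Complex.I) - 1) atTop (nhds 0) := by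
    refine squeeze_zero_norm (fun n => norm_exp_mul_I_sub_one_le (θ n)) ?_
    simpa using hθ.abs
  have h1 : Tendsto (fun n : ℕ => (Complex.exp (θ n * Complex.I) - 1) / 2 *
      (((harmonic n : ℝ) - Real.log n : ℝ) : ℂ)) atTop (nhds 0) := by
    have := (hw.div_const 2).mul
      ((Complex.continuous_ofReal.tendsto _).comp Real.tendsto_harmonic_sub_log)
    simpa using this
  have h2 : Tendsto (fun n : ℕ => (L n : ℂ) *
      (Complex.exp (θ n * Complex.I) - 1 - θ n * Complex.I)) atTop
      (nhds (-(t : ℂ) ^ 2 / 2)) := by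
    rw [tendsto_iff_norm_sub_tendsto_zero]
    have hlim : Tendsto (fun n => t ^ 2 * |θ n|) atTop (nhds 0) := by
      simpa using hθ.abs.const_mul (t ^ 2)
    refine squeeze_zero' (.of_forall fun n => norm_nonneg _) ?_ hlim
    have hsmall : ∀ᶠ n in atTop, |θ n| ≤ 1 := by
      have := hθ.abs
      rw [abs_zero] at this
      exact this.eventually_le_const one_pos
    filter_upwards [hsmall, hLθ] with n hn hn'
    have hc : (t : ℂ) ^ 2 = L n * (θ n : ℂ) ^ 2 := by exact_mod_cast hn'.symm
    have hLnn : 0 ≤ L n := by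
      rw [hL]
      exact div_nonneg (Real.log_natCast_nonneg n) zero_le_two
    have he : (L n : ℂ) * (Complex.exp (θ n * Complex.I) - 1 - θ n * Complex.I) -
        -(t : ℂ) ^ 2 / 2 =
        L n * (Complex.exp (θ n * Complex.I) - 1 - θ n * Complex.I + (θ n : ℂ) ^ 2 / 2) := by
      rw [hc]
      ring
    rw [he, norm_mul, Complex.norm_of_nonneg hLnn, ← hn', ← sq_abs (θ n)]
    calc L n * _ ≤ L n * |θ n| ^ 3 :=
          mul_le_mul_of_nonneg_left (norm_exp_mul_I_sub_le hn) hLnn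
      _ = _ := by ring
  have h12 := h1.add h2
  rw [zero_add] at h12
  refine h12.congr fun n => ?_
  have hharm : ∑ k ∈ Finset.range n,
      (Complex.exp (θ n * Complex.I) - 1) / (2 * ((k : ℂ) + 1)) =
      (Complex.exp (θ n * Complex.I) - 1) / 2 * (harmonic n : ℂ) := by
    rw [harmonic]
    push_cast
    rw [Finset.mul_sum]
    refine Finset.sum_congr rfl fun k _ => ?_
    rw [← div_div, div_eq_mul_inv _ ((k : ℂ) + 1)]
  rw [hharm, hL]
  push_cast
  ring

namespace StaircaseTableau

lemma charFun_standardized_r (n : ℕ) (a s t : ℝ) :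
    charFun ((tableauMeasure n).map fun S => ((S.r : ℝ) - a) / s) t =
      Complex.exp (-(a * ((t / s : ℝ) * Complex.I))) *
        charFun ((tableauMeasure n).map fun S => (S.r : ℝ)) (t / s) := by
  rw [charFun_apply_real, charFun_apply_real, integral_map (by fun_prop) (by fun_prop),
    integral_map (by fun_prop) (by fun_prop), ← integral_const_mul]
  congr 1
  funext S
  rw [← Complex.exp_add]
  congr 1
  push_cast
  ring

theorem tendstoInDistribution_r :
    TendstoInDistribution
      (fun (n : ℕ) (S : StaircaseTableau n) =>
        ((S.r : ℝ) - Real.log n / 2) / Real.sqrt (Real.log n / 2))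
      atTop (id : ℝ → ℝ) tableauMeasure (gaussianReal 0 1) := by
  refine ⟨fun n => by fun_prop, aemeasurable_id, ?_⟩
  refine ProbabilityMeasure.tendsto_iff_tendsto_charFun.2 fun t => ?_
  simp only [ProbabilityMeasure.coe_mk, Measure.map_id, charFun_gaussianReal,
    charFun_standardized_r, charFun_r]
  set L : ℕ → ℝ := fun n => Real.log n / 2 with hL
  set θ : ℕ → ℝ := fun n => t / Real.sqrt (L n) with hθdef
  have hLtop : Tendsto L atTop atTop :=
    (Real.tendsto_log_atTop.comp tendsto_natCast_atTop_atTop).atTop_div_const two_pos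
  have hθ : Tendsto θ atTop (nhds 0) :=
    (Real.tendsto_sqrt_atTop.comp hLtop).const_div_atTop t
  have hLθ : ∀ᶠ n in atTop, L n * θ n ^ 2 = t ^ 2 := by
    filter_upwards [hLtop.eventually_gt_atTop 0] with n hn
    rw [hθdef]
    simp only
    rw [div_pow, Real.sq_sqrt hn.le]
    field_simp
  have hmain := (tendsto_sum_sub t L θ (fun _ => rfl) hθ hLθ).cexp
  have herr : Tendsto (fun n : ℕ => Complex.exp (-(L n * (θ n * Complex.I))) *
      (∏ k ∈ Finset.range n, (1 + (Complex.exp (θ n * Complex.I) - 1) / (2 * ((k : ℂ) + 1))) -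
        Complex.exp (∑ k ∈ Finset.range n,
          (Complex.exp (θ n * Complex.I) - 1) / (2 * ((k : ℂ) + 1))))) atTop (nhds 0) := by
    have hlim : Tendsto (fun n => θ n ^ 2 * ∑' k : ℕ, 1 / ((k : ℝ) + 1) ^ 2) atTop (nhds 0) := by
      have := (hθ.pow 2).mul_const (∑' k : ℕ, 1 / ((k : ℝ) + 1) ^ 2)
      rwa [zero_pow two_ne_zero, zero_mul] at this
    refine squeeze_zero_norm (fun n => ?_) hlim
    have hunit : ‖Complex.exp (-(L n * (θ n * Complex.I)))‖ = 1 := by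
      rw [show -((L n : ℂ) * (θ n * Complex.I)) = ((-(L n * θ n) : ℝ) : ℂ) * Complex.I by
        push_cast
        ring, Complex.norm_exp_ofReal_mul_I]
    rw [norm_mul, hunit, one_mul]
    exact norm_prod_sub_exp_sum_le n (θ n)
  have hadd := herr.add hmain
  rw [zero_add] at hadd
  have hgauss : (t : ℂ) * ((0 : ℝ) : ℂ) * Complex.I - ((1 : NNReal) : ℝ) * (t : ℂ) ^ 2 / 2 =
      -(t : ℂ) ^ 2 / 2 := by
    push_cast
    ring
  rw [hgauss]
  refine hadd.congr fun n => ?_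
  rw [Complex.exp_sub, div_eq_mul_inv (Complex.exp _), ← Complex.exp_neg]
  ring

end StaircaseTableau

theorem corollary7 :
    -- equality in law of `r_n` with a sum of independent Bernoulli variables
    (∀ n : ℕ, 1 ≤ n →
      (∃ (Ω : Type) (_ : MeasurableSpace Ω) (P : Measure Ω) (J : Fin n → Ω → ℕ),
        IsProbabilityMeasure P ∧ IsIndepBernoulliFamily n P J) ∧
      (∀ (Ω : Type*) [MeasurableSpace Ω] (P : Measure Ω) [IsProbabilityMeasure P]
        (J : Fin n → Ω → ℕ), IsIndepBernoulliFamily n P J →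
          IdentDistrib (fun S : StaircaseTableau n => S.r) (fun ω => ∑ i, J i ω)
            (tableauMeasure n) P)) ∧
    -- expected value
    (∀ n : ℕ, 1 ≤ n →
      ∫ S : StaircaseTableau n, (S.r : ℝ) ∂(tableauMeasure n)
          = ∑ k ∈ Finset.Icc 1 n, 1 / (2 * (k : ℝ)) ∧
      ∫ S : StaircaseTableau n, (S.r : ℝ) ∂(tableauMeasure n)
          = (∑ k ∈ Finset.Icc 1 n, 1 / (k : ℝ)) / 2) ∧
    -- variance
    (∀ n : ℕ, 1 ≤ n →
      variance (fun S : StaircaseTableau n => (S.r : ℝ)) (tableauMeasure n)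
          = ∑ k ∈ Finset.Icc 1 n, 1 / (2 * (k : ℝ)) * (1 - 1 / (2 * (k : ℝ))) ∧
      variance (fun S : StaircaseTableau n => (S.r : ℝ)) (tableauMeasure n)
          = (∑ k ∈ Finset.Icc 1 n, 1 / (k : ℝ)) / 2
            - (∑ k ∈ Finset.Icc 1 n, 1 / (k : ℝ) ^ 2) / 4) ∧
    -- central limit theorem
    TendstoInDistribution
      (fun (n : ℕ) (S : StaircaseTableau n) =>
        ((S.r : ℝ) - Real.log n / 2) / Real.sqrt (Real.log n / 2))
      atTop (id : ℝ → ℝ) tableauMeasure (gaussianReal 0 1) := by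
  refine ⟨fun n _ => ⟨exists_isIndepBernoulliFamily n, fun Ω _ P _ J h => h.identDistrib_r⟩,
    fun n _ => ⟨StaircaseTableau.integral_r n, ?_⟩,
    fun n _ => ⟨StaircaseTableau.variance_r n, ?_⟩, StaircaseTableau.tendstoInDistribution_r⟩
  · rw [StaircaseTableau.integral_r, Finset.sum_div]
    refine Finset.sum_congr rfl fun k _ => ?_
    rw [div_div, mul_comm]
  · rw [StaircaseTableau.variance_r, Finset.sum_div, Finset.sum_div, ← Finset.sum_sub_distrib]
    refine Finset.sum_congr rfl fun k _ => ?_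
    ring
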